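/- A fluid network $(\alpha,\mu,P,C)$ consists of $K$ fluid classes and $J$ stations, a map $s:\{1,\dots,K\}\to\{1,\dots,J\}$ (class $k$ is served at station $s(k)$) with $J\times K$ constituency matrix $C$, $c_{jk}=1$ if $s(k)=j$ and $c_{jk}=0$ otherwise, nonnegative vectors $\alpha,\mu\in\mathbb{R}_+^K$ (inflow rates and potential outflow rates), and a $K\times K$ substochastic matrix $P$ (nonnegative entries, row sums at most $1$) with spectral radius strictly less than one. Let $M=\operatorname{diag}(\mu)$ and let $e=(1,\dots,1)^T\in\mathbb{R}^J$. For an initial level $Q_0\in\mathbb{R}_+^K$, a fluid solution of the work-conserving fluid network is a pair of functions $Q,T:[0,\infty)\to\mathbb{R}^K$ such that $$Q(t)=Q_0+\alpha t-(I-P^T)M\,T(t)\ge 0\quad\text{for all } t\ge 0,$$ $$T(0)=0\ \text{ and } T(\cdot)\text{ is nondecreasing},$$ $$I(t)=et-C\,T(t)\ \text{ and } I(\cdot)\text{ is nondecreasing},$$ $$\int_0^\infty (C\,Q(t))^T\,dI(t)=0,$$ where inequalities and monotonicity are understood componentwise, and the last integral is the sum over the stations $j$ of the Lebesgue--Stieltjes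 integrals of $(C\,Q(t))_j$ with respect to $I_j$. **Theorem.** For every fluid network $(\alpha,\mu,P,C)$ and every initial level $Q_0\in\mathbb{R}_+^K$, the set $$\mathcal{Q}_C=\{Q(\cdot)\,:\,\exists\,T(\cdot)\text{ such that }(Q(\cdot),T(\cdot))\text{ is a fluid solution with initial level }Q_0\}$$ is nonempty. -/

import Mathlib

open scoped NNReal ENNReal Matrix

/-- A fluid network with `K` fluid classes and `J` stations. The constituency matrix is given by
the map `s` (see `FluidNetwork.C`); a station that serves no class is allowed. -/
structure FluidNetwork (K J : ℕ) where
  /-- exogenous inflow rates -/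
  α : Fin K → ℝ
  /-- potential outflow rates -/
  μ : Fin K → ℝ
  /-- routing matrix: `P k l` is the proportion of the outflow of class `k` that turns into
  class `l` -/
  P : Matrix (Fin K) (Fin K) ℝ
  /-- `s k` is the station that serves class `k` -/
  s : Fin K → Fin J
  α_nonneg : ∀ k, 0 ≤ α k
  μ_nonneg : ∀ k, 0 ≤ μ k
  P_nonneg : ∀ k l, 0 ≤ P k l
  P_row_sum_le_one : ∀ k, ∑ l, P k l ≤ 1
  /-- The spectral radius (the largest modulus of a complex eigenvalue) of `P` is less than one. -/
  P_spectralRadius_lt_one : spectralRadius ℂ (P.map (fun x : ℝ => (x : ℂ))) < 1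

namespace FluidNetwork

variable {K J : ℕ}

/-- The constituency matrix: `C j k = 1` if class `k` is served at station `j`, and `0` if not. -/
def C (N : FluidNetwork K J) : Matrix (Fin J) (Fin K) ℝ :=
  Matrix.of fun j k => if N.s k = j then 1 else 0

/-- The matrix `M = diag(μ)`. -/
def M (N : FluidNetwork K J) : Matrix (Fin K) (Fin K) ℝ :=
  Matrix.diagonal N.μ

/-- The cumulative idle time process `I(t) = e t - C T(t)` of an allocation process `T`, where
`e` is the vector of ones. -/
def idleTime (N : FluidNetwork K J) (T : ℝ≥0 → Fin K → ℝ) (t : ℝ≥0) : Fin J → ℝ :=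
  (t : ℝ) • (1 : Fin J → ℝ) - N.C *ᵥ T t

/-- `(Q, T)` is a fluid solution of the work-conserving fluid network `N` with initial fluid
level `Q₀`. Time is `[0, ∞) = ℝ≥0`, and vectors are ordered componentwise. -/
structure IsFluidSolution (N : FluidNetwork K J) (Q₀ : Fin K → ℝ)
    (Q T : ℝ≥0 → Fin K → ℝ) : Prop where
  /-- flow balance: `Q(t) = Q₀ + α t - (I - Pᵀ) M T(t)` -/
  flow_balance : ∀ t : ℝ≥0, Q t = Q₀ + (t : ℝ) • N.α - ((1 - N.Pᵀ) * N.M) *ᵥ T t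
  level_nonneg : ∀ t : ℝ≥0, 0 ≤ Q t
  allocation_zero : T 0 = 0
  allocation_mono : Monotone T
  idle_mono : ∀ j, Monotone fun t : ℝ≥0 => N.idleTime T t j
  /-- work conservation: `∫₀^∞ (C Q(t))ᵀ dI(t) = ∑ j, ∫₀^∞ (C Q(t))_j dI_j(t) = 0`. The integrands
  are nonnegative, and the integrals are taken against the Lebesgue–Stieltjes measures of the
  nondecreasing functions `I_j` (which are continuous, by monotonicity of `T` and `I`). -/
  work_conserving :
    ∑ j, ∫⁻ t, ENNReal.ofReal ((N.C *ᵥ Q t) j) ∂(idle_mono j).stieltjesFunction.measure = 0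

/-- The set of all fluid level processes of the work-conserving fluid network `N` with initial
fluid level `Q₀`. -/
def levelProcesses (N : FluidNetwork K J) (Q₀ : Fin K → ℝ) : Set (ℝ≥0 → Fin K → ℝ) :=
  {Q | ∃ T : ℝ≥0 → Fin K → ℝ, N.IsFluidSolution Q₀ Q T}

end FluidNetwork

/-!
A fluid solution is obtained as a limit of discrete-time approximations with time step `h → 0`.

In the approximation, during each step class `k` receives the fraction `q_k / (ε + (C q)_{s(k)})`
of the capacity of its station, where `q` is the level at the start of the step and `ε` is
proportional to `h` (`FluidNetwork.allocRate`). Because `μ_k h ≤ ε`, a step never removes more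
fluid from a class than is present, so levels stay nonnegative (`FluidNetwork.eulerLevel_nonneg`).
On the other hand, a station with content `S = (C q)_j` idles only for the fraction
`ε / (ε + S)` of the step, so while `S ≥ δ` it accumulates idle time at rate at most `ε / δ`
(`FluidNetwork.eulerIdle_sub_le`).

Allocations are nondecreasing and at most `t` at time `t`, so they converge pointwise along an
ultrafilter as `h → 0`. Flow balance, nonnegativity and monotonicity are closed conditions and pass
to the limit. For work conservation, let `(C Q(t₀))_j > 0`. The approximate levels are
Lipschitz at the scale of the grid, with a constant independent of `h`
(`FluidNetwork.abs_eulerContent_sub_le`); hence near `t₀` the content of station `j` is bounded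
away from `0` along the approximations and, as `ε → 0`, the limit idle time `I_j` is constant near
`t₀` (`FluidNetwork.IsEulerLimit.idleTime_eq_of_content_pos`). Thus `{t | (C Q(t))_j > 0}` is locally null, hence
null, for the Lebesgue–Stieltjes measure of `I_j`, which is the work-conservation condition.
-/

open Filter Topology MeasureTheory

namespace FluidNetwork

variable {K J : ℕ} (N : FluidNetwork K J)

/-! ### The linear maps of the network -/

lemma C_mulVec_apply (x : Fin K → ℝ) (j : Fin J) :
    (N.C *ᵥ x) j = ∑ k, if N.s k = j then x k else 0 := by
  simp [C, Matrix.mulVec, dotProduct]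

lemma C_mulVec_nonneg {x : Fin K → ℝ} (hx : 0 ≤ x) : 0 ≤ N.C *ᵥ x := by
  intro j
  rw [C_mulVec_apply]
  exact Finset.sum_nonneg fun k _ => by split_ifs; exacts [hx k, le_rfl]

lemma le_C_mulVec {x : Fin K → ℝ} (hx : 0 ≤ x) (k : Fin K) : x k ≤ (N.C *ᵥ x) (N.s k) := by
  rw [C_mulVec_apply]
  refine le_trans (by simp) (Finset.single_le_sum (a := k) (fun l _ => ?_) (Finset.mem_univ k))
  split_ifs
  exacts [hx l, le_rfl]

lemma abs_C_mulVec_le (x : Fin K → ℝ) (j : Fin J) : |(N.C *ᵥ x) j| ≤ ∑ k, |x k| := by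
  rw [C_mulVec_apply]
  refine (Finset.abs_sum_le_sum_abs _ _).trans (Finset.sum_le_sum fun k _ => ?_)
  split_ifs
  exacts [le_rfl, by simp]

lemma flow_mulVec_apply (x : Fin K → ℝ) (k : Fin K) :
    (((1 - N.Pᵀ) * N.M) *ᵥ x) k = N.μ k * x k - ∑ l, N.P l k * (N.μ l * x l) := by
  have hM : N.M *ᵥ x = fun l => N.μ l * x l := funext fun l => Matrix.mulVec_diagonal _ _ l
  rw [← Matrix.mulVec_mulVec, Matrix.sub_mulVec, Matrix.one_mulVec, hM]
  simp [Matrix.mulVec, dotProduct]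

/-- The fluid level `Q₀ + α t - (I - Pᵀ) M x` at time `t` after a cumulative allocation `x`. -/
def flow (Q₀ : Fin K → ℝ) (t : ℝ) (x : Fin K → ℝ) : Fin K → ℝ :=
  Q₀ + t • N.α - ((1 - N.Pᵀ) * N.M) *ᵥ x

/-! ### The discrete-time approximation -/

/-- Proportional sharing, regularised by `ε`: the fraction of its station's capacity that class `k`
receives at the level `q`. -/
noncomputable def allocRate (ε : ℝ) (q : Fin K → ℝ) (k : Fin K) : ℝ :=
  q k / (ε + (N.C *ᵥ q) (N.s k))

/-- The regularisation parameter for the time step `h`. The factor `1 + ∑ μ` ensures `μ k * h ≤ ε`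
and `0 < ε`. -/
noncomputable def regParam (h : ℝ) : ℝ := (1 + ∑ k, N.μ k) * h

/-- The cumulative allocation after `i` steps of length `h` of the explicit Euler scheme for
proportional sharing. -/
noncomputable def eulerAlloc (Q₀ : Fin K → ℝ) (h : ℝ) : ℕ → Fin K → ℝ
  | 0 => 0
  | i + 1 => eulerAlloc Q₀ h i +
      h • N.allocRate (N.regParam h) (N.flow Q₀ (i * h) (eulerAlloc Q₀ h i))

/-- The fluid level after `i` steps of the Euler scheme. -/
noncomputable def eulerLevel (Q₀ : Fin K → ℝ) (h : ℝ) (i : ℕ) : Fin K → ℝ :=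
  N.flow Q₀ (i * h) (N.eulerAlloc Q₀ h i)

/-- The cumulative idle time after `i` steps of the Euler scheme. -/
noncomputable def eulerIdle (Q₀ : Fin K → ℝ) (h : ℝ) (i : ℕ) (j : Fin J) : ℝ :=
  i * h - (N.C *ᵥ N.eulerAlloc Q₀ h i) j

lemma allocRate_nonneg {ε : ℝ} (hε : 0 < ε) {q : Fin K → ℝ} (hq : 0 ≤ q) :
    0 ≤ N.allocRate ε q := fun k =>
  div_nonneg (hq k) (add_nonneg hε.le (N.C_mulVec_nonneg hq _))

lemma C_mulVec_allocRate (ε : ℝ) (q : Fin K → ℝ) (j : Fin J) :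
    (N.C *ᵥ N.allocRate ε q) j = (N.C *ᵥ q) j / (ε + (N.C *ᵥ q) j) := by
  rw [C_mulVec_apply]
  conv_rhs => rw [C_mulVec_apply, Finset.sum_div]
  refine Finset.sum_congr rfl fun k _ => ?_
  split_ifs with hk
  · rw [allocRate, hk, N.C_mulVec_apply]
  · simp

lemma one_sub_C_mulVec_allocRate {ε : ℝ} (hε : 0 < ε) {q : Fin K → ℝ} (hq : 0 ≤ q) (j : Fin J) :
    1 - (N.C *ᵥ N.allocRate ε q) j = ε / (ε + (N.C *ᵥ q) j) := by
  have := N.C_mulVec_nonneg hq j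
  simp only [Pi.zero_apply] at this
  rw [C_mulVec_allocRate]
  have : ε + (N.C *ᵥ q) j ≠ 0 := by positivity
  field_simp
  ring

lemma allocRate_le_one {ε : ℝ} (hε : 0 < ε) {q : Fin K → ℝ} (hq : 0 ≤ q) (k : Fin K) :
    N.allocRate ε q k ≤ 1 := by
  have h1 := N.C_mulVec_nonneg hq (N.s k)
  have h2 := N.le_C_mulVec hq k
  simp only [Pi.zero_apply] at h1
  exact div_le_one_of_le₀ (by linarith) (by linarith)

lemma one_le_one_add_sum : 1 ≤ 1 + ∑ k, N.μ k := by
  linarith [Finset.sum_nonneg fun k (_ : k ∈ Finset.univ) => N.μ_nonneg k]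

lemma regParam_pos {h : ℝ} (hh : 0 < h) : 0 < N.regParam h :=
  mul_pos (by linarith [N.one_le_one_add_sum]) hh

lemma mul_le_regParam {h : ℝ} (hh : 0 < h) (k : Fin K) : N.μ k * h ≤ N.regParam h := by
  have := Finset.single_le_sum (fun k _ => N.μ_nonneg k) (Finset.mem_univ k)
  exact mul_le_mul_of_nonneg_right (by linarith) hh.le

lemma eulerLevel_succ (Q₀ : Fin K → ℝ) (h : ℝ) (i : ℕ) (k : Fin K) :
    N.eulerLevel Q₀ h (i + 1) k = N.eulerLevel Q₀ h i k + h * (N.α k -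
      (((1 - N.Pᵀ) * N.M) *ᵥ N.allocRate (N.regParam h) (N.eulerLevel Q₀ h i)) k) := by
  simp only [eulerLevel, flow, eulerAlloc, Matrix.mulVec_add, Matrix.mulVec_smul, Pi.add_apply,
    Pi.sub_apply, Pi.smul_apply, smul_eq_mul, Nat.cast_add, Nat.cast_one]
  ring

lemma eulerLevel_nonneg {Q₀ : Fin K → ℝ} (hQ₀ : 0 ≤ Q₀) {h : ℝ} (hh : 0 < h) (i : ℕ) :
    0 ≤ N.eulerLevel Q₀ h i := by
  induction i with
  | zero => simpa [eulerLevel, flow, eulerAlloc] using hQ₀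
  | succ i ih =>
    intro k
    set q := N.eulerLevel Q₀ h i with hq
    have hε := N.regParam_pos hh
    have hu := N.allocRate_nonneg hε ih
    rw [eulerLevel_succ, flow_mulVec_apply, ← hq, Pi.zero_apply]
    -- The outflow of class `k` in one step is at most its content, since `μ k * h ≤ ε`.
    have hout : h * (N.μ k * N.allocRate (N.regParam h) q k) ≤ q k := by
      have h1 := N.C_mulVec_nonneg ih (N.s k)
      simp only [Pi.zero_apply] at h1
      have h2 : h * (N.μ k * N.allocRate (N.regParam h) q k) =
          q k * (N.μ k * h / (N.regParam h + (N.C *ᵥ q) (N.s k))) := by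
        rw [allocRate]; ring
      rw [h2]
      refine mul_le_of_le_one_right (ih k) (div_le_one_of_le₀ ?_ (by linarith))
      linarith [N.mul_le_regParam hh k]
    have hin : 0 ≤ ∑ l, N.P l k * (N.μ l * N.allocRate (N.regParam h) q l) :=
      Finset.sum_nonneg fun l _ => mul_nonneg (N.P_nonneg l k) (mul_nonneg (N.μ_nonneg l) (hu l))
    have := mul_nonneg hh.le (add_nonneg (N.α_nonneg k) hin)
    linarith

lemma eulerAlloc_mono {Q₀ : Fin K → ℝ} (hQ₀ : 0 ≤ Q₀) {h : ℝ} (hh : 0 < h) :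
    Monotone (N.eulerAlloc Q₀ h) :=
  monotone_nat_of_le_succ fun i => le_add_of_nonneg_right <| smul_nonneg hh.le <|
    N.allocRate_nonneg (N.regParam_pos hh) (N.eulerLevel_nonneg hQ₀ hh i)

lemma eulerIdle_succ {Q₀ : Fin K → ℝ} (hQ₀ : 0 ≤ Q₀) {h : ℝ} (hh : 0 < h) (i : ℕ) (j : Fin J) :
    N.eulerIdle Q₀ h (i + 1) j = N.eulerIdle Q₀ h i j +
      h * (N.regParam h / (N.regParam h + (N.C *ᵥ N.eulerLevel Q₀ h i) j)) := by
  rw [← N.one_sub_C_mulVec_allocRate (N.regParam_pos hh) (N.eulerLevel_nonneg hQ₀ hh i)]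
  simp only [eulerIdle, eulerAlloc, eulerLevel, Matrix.mulVec_add, Matrix.mulVec_smul, Pi.add_apply,
    Pi.smul_apply, smul_eq_mul, Nat.cast_add, Nat.cast_one]
  ring

lemma eulerIdle_mono {Q₀ : Fin K → ℝ} (hQ₀ : 0 ≤ Q₀) {h : ℝ} (hh : 0 < h) (j : Fin J) :
    Monotone fun i => N.eulerIdle Q₀ h i j := by
  refine monotone_nat_of_le_succ fun i => ?_
  rw [N.eulerIdle_succ hQ₀ hh]
  have := N.C_mulVec_nonneg (N.eulerLevel_nonneg hQ₀ hh i) j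
  simp only [Pi.zero_apply] at this
  have := N.regParam_pos hh
  exact le_add_of_nonneg_right (by positivity)

lemma eulerAlloc_le {Q₀ : Fin K → ℝ} (hQ₀ : 0 ≤ Q₀) {h : ℝ} (hh : 0 < h) (i : ℕ) (k : Fin K) :
    N.eulerAlloc Q₀ h i k ≤ i * h := by
  have h1 := N.eulerIdle_mono hQ₀ hh (N.s k) (Nat.zero_le i)
  have h2 := N.le_C_mulVec (N.eulerAlloc_mono hQ₀ hh (Nat.zero_le i)) k
  simp only [eulerIdle, eulerAlloc, Nat.cast_zero, zero_mul, Matrix.mulVec_zero, Pi.zero_apply,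
    sub_zero] at h1
  linarith

/-- While the content of station `j` is at least `δ`, its idle time grows at rate at most
`ε / δ`. -/
lemma eulerIdle_sub_le {Q₀ : Fin K → ℝ} (hQ₀ : 0 ≤ Q₀) {h : ℝ} (hh : 0 < h) {δ : ℝ} (hδ : 0 < δ)
    (j : Fin J) {a b : ℕ} (hab : a ≤ b)
    (hS : ∀ i, a ≤ i → i < b → δ ≤ (N.C *ᵥ N.eulerLevel Q₀ h i) j) :
    N.eulerIdle Q₀ h b j - N.eulerIdle Q₀ h a j ≤ (b * h - a * h) * (N.regParam h / δ) := by
  induction b, hab using Nat.le_induction with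
  | base => simp
  | succ b hab ih =>
    have ih := ih fun i hi hib => hS i hi (hib.trans (Nat.lt_succ_self b))
    have hb := hS b hab (Nat.lt_succ_self b)
    have hε := N.regParam_pos hh
    have : N.regParam h / (N.regParam h + (N.C *ᵥ N.eulerLevel Q₀ h b) j) ≤ N.regParam h / δ :=
      div_le_div_of_nonneg_left hε.le hδ (by linarith)
    rw [N.eulerIdle_succ hQ₀ hh]
    push_cast
    linarith [mul_le_mul_of_nonneg_left this hh.le]

/-- A bound for the speed at which the content of a station can change. -/
noncomputable def speed : ℝ := ∑ k, (N.α k + ∑ l, |((1 - N.Pᵀ) * N.M) k l|)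

lemma speed_nonneg : 0 ≤ N.speed :=
  Finset.sum_nonneg fun k _ => add_nonneg (N.α_nonneg k) (Finset.sum_nonneg fun _ _ => abs_nonneg _)

lemma abs_eulerContent_succ_sub_le {Q₀ : Fin K → ℝ} (hQ₀ : 0 ≤ Q₀) {h : ℝ} (hh : 0 < h)
    (j : Fin J) (i : ℕ) :
    |(N.C *ᵥ N.eulerLevel Q₀ h (i + 1)) j - (N.C *ᵥ N.eulerLevel Q₀ h i) j| ≤ h * N.speed := by
  have hq := N.eulerLevel_nonneg hQ₀ hh i
  have hε := N.regParam_pos hh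
  rw [← Pi.sub_apply, ← Matrix.mulVec_sub]
  refine (N.abs_C_mulVec_le _ _).trans ?_
  rw [speed, Finset.mul_sum]
  refine Finset.sum_le_sum fun k _ => ?_
  rw [Pi.sub_apply, eulerLevel_succ, add_sub_cancel_left, abs_mul, abs_of_pos hh]
  refine mul_le_mul_of_nonneg_left ((norm_sub_le (N.α k) _).trans ?_) hh.le
  rw [Real.norm_of_nonneg (N.α_nonneg k), Real.norm_eq_abs, Matrix.mulVec, dotProduct]
  refine add_le_add le_rfl ?_
  refine (Finset.abs_sum_le_sum_abs _ _).trans (Finset.sum_le_sum fun l _ => ?_)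
  rw [abs_mul, abs_of_nonneg (N.allocRate_nonneg hε hq l)]
  exact mul_le_of_le_one_right (abs_nonneg _) (N.allocRate_le_one hε hq l)

/-- The content of a station is Lipschitz at the scale of the grid, uniformly in the step. -/
lemma abs_eulerContent_sub_le {Q₀ : Fin K → ℝ} (hQ₀ : 0 ≤ Q₀) {h : ℝ} (hh : 0 < h)
    (j : Fin J) (a b : ℕ) :
    |(N.C *ᵥ N.eulerLevel Q₀ h b) j - (N.C *ᵥ N.eulerLevel Q₀ h a) j| ≤
      |b * h - a * h| * N.speed := by
  wlog hab : a ≤ b generalizing a b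
  · rw [abs_sub_comm, abs_sub_comm (b * h)]
    exact this b a (le_of_not_ge hab)
  induction b, hab using Nat.le_induction with
  | base => simp
  | succ b hab ih =>
    have hba : (a : ℝ) * h ≤ b * h := by gcongr
    rw [abs_of_nonneg (sub_nonneg.2 hba)] at ih
    have h1 : ((b + 1 : ℕ) : ℝ) * h - a * h = (b * h - a * h) + h := by push_cast; ring
    rw [h1, abs_of_nonneg (add_nonneg (sub_nonneg.2 hba) hh.le), add_mul]
    have := N.abs_eulerContent_succ_sub_le hQ₀ hh j b
    refine (abs_sub_le _ ((N.C *ᵥ N.eulerLevel Q₀ h b) j) _).trans ?_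
    linarith

end FluidNetwork

/-! ### The time grid -/

/-- The number of grid points of mesh `1 / (n + 1)` in `(0, t]`. -/
noncomputable def gridIndex (n : ℕ) (t : ℝ≥0) : ℕ := ⌊(t : ℝ) * (n + 1)⌋₊

/-- The mesh of the `n`-th time grid. -/
noncomputable def gridStep (n : ℕ) : ℝ := 1 / ((n : ℝ) + 1)

lemma gridStep_pos (n : ℕ) : 0 < gridStep n := Nat.one_div_pos_of_nat

lemma tendsto_gridStep : Tendsto gridStep (hyperfilter ℕ) (𝓝 0) :=
  tendsto_one_div_add_atTop_nhds_zero_nat.mono_left Nat.hyperfilter_le_atTop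

lemma gridIndex_mono (n : ℕ) : Monotone (gridIndex n) := fun s t hst =>
  Nat.floor_le_floor (mul_le_mul_of_nonneg_right (NNReal.coe_le_coe.2 hst) (by positivity))

lemma gridTime_le (n : ℕ) (t : ℝ≥0) : gridIndex n t * gridStep n ≤ t := by
  have h := Nat.floor_le (a := (t : ℝ) * (n + 1)) (by positivity)
  rw [gridStep, mul_one_div, div_le_iff₀ (by positivity)]
  exact h

lemma sub_gridStep_le (n : ℕ) (t : ℝ≥0) : t - gridStep n ≤ gridIndex n t * gridStep n := by
  have h := (Nat.lt_floor_add_one ((t : ℝ) * (n + 1))).le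
  have : (t : ℝ) ≤ (gridIndex n t + 1) * gridStep n := by
    rw [gridStep, mul_one_div, le_div_iff₀ (by positivity)]
    exact h
  linarith

lemma tendsto_gridTime (t : ℝ≥0) :
    Tendsto (fun n => gridIndex n t * gridStep n) (hyperfilter ℕ) (𝓝 (t : ℝ)) := by
  refine tendsto_of_tendsto_of_tendsto_of_le_of_le ?_ tendsto_const_nhds
    (fun n => sub_gridStep_le n t) fun n => gridTime_le n t
  simpa using (tendsto_const_nhds (x := (t : ℝ))).sub tendsto_gridStep

/-! ### Null sets of Lebesgue–Stieltjes measures -/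

/-- The Lebesgue–Stieltjes measure of a continuous monotone function does not charge a set near
each point of which the function is constant. -/
lemma Monotone.stieltjesFunction_measure_eq_zero {f : ℝ≥0 → ℝ} (hf : Monotone f)
    (hc : Continuous f) {U : Set ℝ≥0}
    (hU : ∀ t ∈ U, ∃ r > 0, f (t - r) = f (t + r)) :
    hf.stieltjesFunction.measure U = 0 := by
  have hright : ⇑hf.stieltjesFunction = f := funext fun t => by
    rw [hf.stieltjesFunction_eq, hc.continuousWithinAt.rightLim_eq]
  refine measure_null_of_locally_null U fun t ht => ?_
  obtain ⟨r, hr, hconst⟩ := hU t ht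
  refine ⟨Set.Icc (t - r) (t + r), mem_nhdsWithin_of_mem_nhds ?_, ?_⟩
  · rcases eq_or_ne t 0 with rfl | h0
    · -- At the left end point of `ℝ≥0` the interval is `[0, r]`, a neighbourhood of `0`.
      have : Set.Icc (0 - r) (0 + r) = Set.Iic r := by ext; simp
      rw [this]
      exact Iic_mem_nhds hr
    · exact Icc_mem_nhds (tsub_lt_self (pos_iff_ne_zero.2 h0) hr) (lt_add_of_pos_right t hr)
  · rw [StieltjesFunction.measure_Icc, hright, hc.continuousWithinAt.leftLim_eq, hconst, sub_self,
      ENNReal.ofReal_zero]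

namespace FluidNetwork

variable {K J : ℕ} (N : FluidNetwork K J)

/-! ### The limit of the approximations -/

/-- `T` is the pointwise limit, along a fixed nonprincipal ultrafilter, of the Euler allocations for
the time grids of mesh `1 / (n + 1)`. -/
def IsEulerLimit (Q₀ : Fin K → ℝ) (T : ℝ≥0 → Fin K → ℝ) : Prop :=
  ∀ t, Tendsto (fun n => N.eulerAlloc Q₀ (gridStep n) (gridIndex n t)) (hyperfilter ℕ) (𝓝 (T t))

lemma exists_isEulerLimit {Q₀ : Fin K → ℝ} (hQ₀ : 0 ≤ Q₀) : ∃ T, N.IsEulerLimit Q₀ T := by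
  suffices h : ∀ t : ℝ≥0, ∃ x, Tendsto
      (fun n => N.eulerAlloc Q₀ (gridStep n) (gridIndex n t)) (hyperfilter ℕ) (𝓝 x) by
    choose T hT using h
    exact ⟨T, hT⟩
  intro t
  have hmem : ∀ n, N.eulerAlloc Q₀ (gridStep n) (gridIndex n t) ∈
      Set.Icc (0 : Fin K → ℝ) fun _ => (t : ℝ) := fun n =>
    ⟨N.eulerAlloc_mono hQ₀ (gridStep_pos n) (Nat.zero_le _), fun k =>
      (N.eulerAlloc_le hQ₀ (gridStep_pos n) _ k).trans (gridTime_le n t)⟩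
  obtain ⟨x, -, hx⟩ := (isCompact_Icc (a := (0 : Fin K → ℝ)) (b := fun _ => (t : ℝ))
    ).ultrafilter_le_nhds ((hyperfilter ℕ).map
      fun n => N.eulerAlloc Q₀ (gridStep n) (gridIndex n t))
    (tendsto_principal.2 (Eventually.of_forall hmem))
  exact ⟨x, hx⟩

namespace IsEulerLimit

variable {N} {Q₀ : Fin K → ℝ} {T : ℝ≥0 → Fin K → ℝ}

lemma alloc_zero (hT : N.IsEulerLimit Q₀ T) : T 0 = 0 := by
  refine tendsto_nhds_unique (hT 0) ?_
  simp [gridIndex, eulerAlloc]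

lemma tendsto_level (hT : N.IsEulerLimit Q₀ T) (t : ℝ≥0) :
    Tendsto (fun n => N.eulerLevel Q₀ (gridStep n) (gridIndex n t)) (hyperfilter ℕ)
      (𝓝 (N.flow Q₀ t (T t))) := by
  have h := ((continuous_const (y := (1 - N.Pᵀ) * N.M)).matrix_mulVec
    continuous_id).continuousAt.tendsto.comp (hT t)
  exact ((tendsto_const_nhds (x := Q₀)).add
    ((tendsto_gridTime t).smul (tendsto_const_nhds (x := N.α)))).sub h

lemma tendsto_content (hT : N.IsEulerLimit Q₀ T) (t : ℝ≥0) (j : Fin J) :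
    Tendsto (fun n => (N.C *ᵥ N.eulerLevel Q₀ (gridStep n) (gridIndex n t)) j) (hyperfilter ℕ)
      (𝓝 ((N.C *ᵥ N.flow Q₀ t (T t)) j)) :=
  ((continuous_apply j).comp ((continuous_const (y := N.C)).matrix_mulVec
    continuous_id)).continuousAt.tendsto.comp (hT.tendsto_level t)

lemma tendsto_idle (hT : N.IsEulerLimit Q₀ T) (t : ℝ≥0) (j : Fin J) :
    Tendsto (fun n => N.eulerIdle Q₀ (gridStep n) (gridIndex n t) j) (hyperfilter ℕ)
      (𝓝 (N.idleTime T t j)) := by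
  have h := ((continuous_apply j).comp ((continuous_const (y := N.C)).matrix_mulVec
    continuous_id)).continuousAt.tendsto.comp (hT t)
  simpa [idleTime, eulerIdle, Function.comp_def] using (tendsto_gridTime t).sub h

lemma level_nonneg (hT : N.IsEulerLimit Q₀ T) (hQ₀ : 0 ≤ Q₀) (t : ℝ≥0) :
    0 ≤ N.flow Q₀ t (T t) :=
  ge_of_tendsto' (hT.tendsto_level t) fun n => N.eulerLevel_nonneg hQ₀ (gridStep_pos n) _

lemma alloc_mono (hT : N.IsEulerLimit Q₀ T) (hQ₀ : 0 ≤ Q₀) : Monotone T := fun s t hst =>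
  le_of_tendsto_of_tendsto' (hT s) (hT t) fun n =>
    N.eulerAlloc_mono hQ₀ (gridStep_pos n) (gridIndex_mono n hst)

lemma idle_mono (hT : N.IsEulerLimit Q₀ T) (hQ₀ : 0 ≤ Q₀) (j : Fin J) :
    Monotone fun t => N.idleTime T t j := fun s t hst =>
  le_of_tendsto_of_tendsto' (hT.tendsto_idle s j) (hT.tendsto_idle t j) fun n =>
    N.eulerIdle_mono hQ₀ (gridStep_pos n) j (gridIndex_mono n hst)

end IsEulerLimit

/-- Allocations are continuous because both they and the idle times are nondecreasing: together
these conditions make each component of `T` Lipschitz. -/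
lemma continuous_of_idle_mono {T : ℝ≥0 → Fin K → ℝ} (hmono : Monotone T)
    (hidle : ∀ j, Monotone fun t => N.idleTime T t j) : Continuous T := by
  refine continuous_pi fun k => LipschitzWith.continuous (K := 1) ?_
  refine LipschitzWith.of_le_add fun t s => ?_
  rcases le_total t s with hts | hst
  · linarith [hmono hts k, dist_nonneg (x := t) (y := s)]
  · have h1 := hidle (N.s k) hst
    have h2 := N.le_C_mulVec (sub_nonneg.2 (hmono hst)) k
    simp only [idleTime, Pi.sub_apply, Pi.smul_apply, Pi.one_apply, smul_eq_mul, mul_one,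
      Matrix.mulVec_sub] at h1 h2
    have h3 : (t : ℝ) - s ≤ dist t s := by rw [NNReal.dist_eq]; exact le_abs_self _
    linarith

lemma continuous_idleTime {T : ℝ≥0 → Fin K → ℝ} (hT : Continuous T) (j : Fin J) :
    Continuous fun t => N.idleTime T t j := by
  have h := (continuous_apply j).comp ((continuous_const (y := N.C)).matrix_mulVec hT)
  simpa [idleTime, Function.comp_def, Pi.sub_def] using NNReal.continuous_coe.sub h

/-- A station with positive content at time `t₀` does not idle near `t₀`. -/
lemma IsEulerLimit.idleTime_eq_of_content_pos {N : FluidNetwork K J} {Q₀ : Fin K → ℝ}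
    {T : ℝ≥0 → Fin K → ℝ} (hT : N.IsEulerLimit Q₀ T) (hQ₀ : 0 ≤ Q₀) {j : Fin J} {t₀ : ℝ≥0}
    (hpos : 0 < (N.C *ᵥ N.flow Q₀ t₀ (T t₀)) j) :
    ∃ r > 0, N.idleTime T (t₀ - r) j = N.idleTime T (t₀ + r) j := by
  set δ : ℝ := (N.C *ᵥ N.flow Q₀ t₀ (T t₀)) j / 3 with hδdef
  have hδ : 0 < δ := by positivity
  have hsp : 0 < N.speed + 1 := by linarith [N.speed_nonneg]
  -- Within time `2 r` the content changes by at most `δ`; one of the two `r` absorbs the rounding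
  -- of times to the grid.
  obtain ⟨r, hr⟩ : ∃ r : ℝ≥0, (r : ℝ) = δ / (2 * (N.speed + 1)) := ⟨⟨_, by positivity⟩, rfl⟩
  have hr0 : (0 : ℝ) < r := by rw [hr]; positivity
  have hrδ : 2 * (r : ℝ) * N.speed ≤ δ := by
    have : 2 * (r : ℝ) * (N.speed + 1) = δ := by rw [hr]; field_simp
    nlinarith
  have hle : t₀ - r ≤ t₀ + r := tsub_le_self.trans le_self_add
  refine ⟨r, hr0, le_antisymm (hT.idle_mono hQ₀ j hle) ?_⟩
  have hsub : (t₀ : ℝ) - r ≤ (t₀ - r : ℝ≥0) := by rw [NNReal.coe_sub_def]; exact le_max_left _ _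
  have hbound : ∀ᶠ n in (hyperfilter ℕ : Filter ℕ),
      N.eulerIdle Q₀ (gridStep n) (gridIndex n (t₀ + r)) j -
        N.eulerIdle Q₀ (gridStep n) (gridIndex n (t₀ - r)) j ≤
      (gridIndex n (t₀ + r) * gridStep n - gridIndex n (t₀ - r) * gridStep n) *
        (N.regParam (gridStep n) / δ) := by
    filter_upwards [(hT.tendsto_content t₀ j).eventually_const_lt (show 2 * δ < _ by linarith),
      tendsto_gridStep.eventually_lt_const hr0] with n hn hstep
    have hh := gridStep_pos n
    refine N.eulerIdle_sub_le hQ₀ hh hδ j (gridIndex_mono n hle) fun i hi1 hi2 => ?_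
    have h1 : (gridIndex n (t₀ - r) : ℝ) * gridStep n ≤ i * gridStep n := by gcongr
    have h2 : (i : ℝ) * gridStep n ≤ gridIndex n (t₀ + r) * gridStep n := by gcongr
    have h3 := sub_gridStep_le n (t₀ - r)
    have h4 := gridTime_le n (t₀ + r)
    have h5 := sub_gridStep_le n t₀
    have h6 := gridTime_le n t₀
    rw [NNReal.coe_add] at h4
    have habs : |(i : ℝ) * gridStep n - gridIndex n t₀ * gridStep n| ≤ 2 * r := by
      rw [abs_le]
      constructor <;> linarith
    have h7 := (abs_le.1 (N.abs_eulerContent_sub_le hQ₀ hh j (gridIndex n t₀) i)).1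
    have h8 := mul_le_mul_of_nonneg_right habs N.speed_nonneg
    linarith
  have hreg : Tendsto (fun n => N.regParam (gridStep n) / δ) (hyperfilter ℕ) (𝓝 0) := by
    simpa [regParam] using (tendsto_gridStep.const_mul (1 + ∑ k, N.μ k)).div_const δ
  have hlim := le_of_tendsto_of_tendsto
    ((hT.tendsto_idle (t₀ + r) j).sub (hT.tendsto_idle (t₀ - r) j))
    (((tendsto_gridTime (t₀ + r)).sub (tendsto_gridTime (t₀ - r))).mul hreg) hbound
  rw [mul_zero] at hlim
  exact sub_nonpos.1 hlim

/-- A limit of the Euler allocations, with the levels given by flow balance, is a fluid solution. -/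
theorem IsEulerLimit.isFluidSolution {N : FluidNetwork K J} {Q₀ : Fin K → ℝ}
    {T : ℝ≥0 → Fin K → ℝ} (hT : N.IsEulerLimit Q₀ T) (hQ₀ : 0 ≤ Q₀) :
    N.IsFluidSolution Q₀ (fun t => N.flow Q₀ t (T t)) T where
  flow_balance _ := rfl
  level_nonneg := hT.level_nonneg hQ₀
  allocation_zero := hT.alloc_zero
  allocation_mono := hT.alloc_mono hQ₀
  idle_mono := hT.idle_mono hQ₀
  work_conserving := by
    have hc := N.continuous_of_idle_mono (hT.alloc_mono hQ₀) (hT.idle_mono hQ₀)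
    refine Finset.sum_eq_zero fun j _ => ?_
    refine lintegral_eq_zero_of_ae_eq_zero (ae_iff.2 ?_)
    refine (hT.idle_mono hQ₀ j).stieltjesFunction_measure_eq_zero (N.continuous_idleTime hc j)
      fun t ht => hT.idleTime_eq_of_content_pos hQ₀ ?_
    simpa using ht

end FluidNetwork

theorem theorem5 {K J : ℕ} (N : FluidNetwork K J) (Q₀ : Fin K → ℝ) (hQ₀ : ∀ k, 0 ≤ Q₀ k) :
    (N.levelProcesses Q₀).Nonempty := by
  obtain ⟨T, hT⟩ := N.exists_isEulerLimit hQ₀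
  exact ⟨_, T, hT.isFluidSolution hQ₀⟩
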